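/- Let $\omega$ be the space of complex sequences with the topology of pointwise convergence, $c_{00}\subset\omega$ the finitely supported sequences, and $(e_j)_{j\ge1}$ the unit vectors. A finite set $A=\{n_1<\dots<n_k\}\subset\mathbb N=\{1,2,\dots\}$ is admissible if $k\le n_1$. The Schreier space $\mathcal S$ is the completion of $c_{00}$ under $\|x\|_{\mathcal S}=\sup_{A\text{ admissible}}\sum_{j\in A}|x_j|$, regarded as a space of sequences. Its 2-convexification is $\mathcal S^2=\{x\in\omega:|x|^2\in\mathcal S\}$ with the norm $\|x\|_{\mathcal S^2}=\||x|^2\|_{\mathcal S}^{1/2}$. The dual $(\mathcal S^2)^*$ is regarded as a space of sequences through the pairing $\sum_j x_jy_j$. Let $\mathcal F_\infty$ be the space of all functions $F:\{z\in\mathbb C:0\le\operatorname{Re}z\le1\}\to\omega$ that are bounded and continuous, analytic on $\{0<\operatorname{Re}z<1\}$, and such that $t\mapsto F(it)\in\mathcal S^2$ and $t\mapsto F(1+it)\in(\mathcal S^2)^*$ are bounded and continuous functions on $\mathbb R$ for the norms of these spaces. Put $\|F\|=\max\left(\sup_t\|F(it)\|_{\mathcal S^2},\ \sup_t\|F(1+it)\|_{(\mathcal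 S^2)^*}\right)$. The derived space $Z(\mathcal S^2)$ of $(\mathcal S^2,(\mathcal S^2)^*)_{1/2}$ is the set of all $(x,y)\in\omega\times\omega$ for which $$\|(x,y)\|_{Z(\mathcal S^2)}=\inf\{\|F\|:F\in\mathcal F_\infty,\ F(1/2)=y,\ F'(1/2)=x\}$$ is finite, with this norm. Its natural basis is $v_{2j-1}=(e_j,0)$, $v_{2j}=(0,e_j)$, $j\in\mathbb N$. For $K\ge1$ and $n,m\in\mathbb N$, a sequence $(u_j)_{j\ge1}$ in a normed space has the $E(n,m,K)$-property if there is a set $I\subset\mathbb N$ with $|I|=n$ such that for every $A\subset\mathbb N\setminus I$ with $|A|\le m$ the family $(u_j)_{j\in A}$ is $K$-equivalent to the unit vector basis of $\ell_2^{|A|}$, that is, $$K^{-1}\Big(\sum_{j\in A}|a_j|^2\Big)^{1/2}\le\Big\|\sum_{j\in A}a_ju_j\Big\|\le K\Big(\sum_{j\in A}|a_j|^2\Big)^{1/2}\qquad\text{for all scalars }(a_j)_{j\in A}.$$ **Proposition.** There is a constant $K\ge1$ such that, for every $n\in\mathbb N$, the sequence $(v_j)_{j\ge1}$ in $Z(\mathcal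 S^2)$ has the $E(n,n,K)$-property. -/

import Mathlib

open scoped ENNReal Topology
open Set Filter

noncomputable section

/-! Sequences `x = (x₁, x₂, …)` are functions `ℕ → ℂ`; the function value at `j : ℕ` is the
coordinate with number `j + 1`. -/

/-- The space `ω` of all complex scalar sequences. -/
abbrev Omega : Type := ℕ → ℂ

/-- The unit vector `e_{j+1}` of `ω`. -/
def unitVec (j : ℕ) : Omega := Pi.single j 1

/-- A normed space of sequences that contains the unit vectors and is included continuously in `ω`.
It is given by its norm, extended by the value `∞` to the sequences outside of the space; so the
space itself is `{x | toFun x < ∞}`. -/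
structure SeqSpace where
  toFun : Omega → ℝ≥0∞
  add_le' : ∀ x y, toFun (x + y) ≤ toFun x + toFun y
  smul' : ∀ (c : ℂ) x, toFun (c • x) = ‖c‖ₑ * toFun x
  coord_le' : ∀ j, ∃ C : ℝ≥0∞, C < ∞ ∧ ∀ x, ‖x j‖ₑ ≤ C * toFun x
  unit_lt' : ∀ j, toFun (unitVec j) < ∞

instance : CoeFun SeqSpace (fun _ => Omega → ℝ≥0∞) := ⟨SeqSpace.toFun⟩

namespace SeqSpace

variable (X : SeqSpace)

theorem map_zero : X 0 = 0 := by
  have := X.smul' 0 0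
  simpa using this

/-- The norm of the dual space `X*`, a sequence `y` being identified with the functional
`x ↦ ∑ x_j y_j`. The supremum is over the finitely supported `x` in the unit ball of `X`,
which determine the functional when (as for all spaces used here) they are dense in `X`. -/
def dualNorm (y : Omega) : ℝ≥0∞ :=
  ⨆ (x : ℕ →₀ ℂ) (_ : X x ≤ 1), ‖∑ j ∈ x.support, x j * y j‖ₑ

theorem unit_ne_zero (j : ℕ) : X (unitVec j) ≠ 0 := by
  obtain ⟨C, -, hC⟩ := X.coord_le' j
  intro h
  have h1 := hC (unitVec j)
  rw [h] at h1
  simp [unitVec] at h1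

/-- The dual space `X*` as a space of sequences. -/
def dual : SeqSpace where
  toFun := X.dualNorm
  add_le' y z := by
    refine iSup₂_le fun x hx => ?_
    have h : ∑ j ∈ x.support, x j * (y + z) j
        = ∑ j ∈ x.support, x j * y j + ∑ j ∈ x.support, x j * z j := by
      simp [mul_add, Finset.sum_add_distrib]
    rw [h]
    refine (enorm_add_le _ _).trans (add_le_add ?_ ?_)
    · exact le_iSup₂_of_le x hx le_rfl
    · exact le_iSup₂_of_le x hx le_rfl
  smul' c y := by
    simp only [dualNorm, ENNReal.mul_iSup]
    refine iSup_congr fun x => iSup_congr fun _ => ?_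
    rw [← enorm_mul, Finset.mul_sum]
    congr 1
    exact Finset.sum_congr rfl fun j _ => by simp; ring
  coord_le' j := by
    refine ⟨X (unitVec j), X.unit_lt' j, fun y => ?_⟩
    set c : ℝ := (X (unitVec j)).toReal with hc
    have hc0 : 0 < c := ENNReal.toReal_pos (X.unit_ne_zero j) (X.unit_lt' j).ne
    have hcX : X (unitVec j) = ENNReal.ofReal c := (ENNReal.ofReal_toReal (X.unit_lt' j).ne).symm
    have hnorm : ‖((c⁻¹ : ℝ) : ℂ)‖ₑ = (ENNReal.ofReal c)⁻¹ := by
      rw [← ENNReal.ofReal_inv_of_pos hc0, ← ofReal_norm]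
      congr 1
      rw [Complex.norm_real, Real.norm_of_nonneg (inv_pos.2 hc0).le]
    have hx0 : ENNReal.ofReal c ≠ 0 := by simpa using hc0
    let x : ℕ →₀ ℂ := Finsupp.single j ((c⁻¹ : ℝ) : ℂ)
    have hx : (x : Omega) = ((c⁻¹ : ℝ) : ℂ) • unitVec j := by
      ext k
      by_cases hk : j = k
      · subst hk; simp [x, unitVec]
      · simp [x, unitVec, Ne.symm hk]
    have hX : X x ≤ 1 := by
      rw [hx, X.smul', hnorm, hcX, ENNReal.inv_mul_cancel hx0 ENNReal.ofReal_ne_top]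
    have hs : ∑ k ∈ x.support, x k * y k = ((c⁻¹ : ℝ) : ℂ) * y j := by
      have : x.sum (fun k a => a * y k) = ((c⁻¹ : ℝ) : ℂ) * y j :=
        Finsupp.sum_single_index (by simp)
      simpa [Finsupp.sum] using this
    have hle : (ENNReal.ofReal c)⁻¹ * ‖y j‖ₑ ≤ X.dualNorm y := by
      rw [← hnorm, ← enorm_mul, ← hs]
      exact le_iSup₂_of_le x hX le_rfl
    rw [hcX]
    calc ‖y j‖ₑ = ENNReal.ofReal c * ((ENNReal.ofReal c)⁻¹ * ‖y j‖ₑ) := by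
          rw [← mul_assoc, ENNReal.mul_inv_cancel hx0 ENNReal.ofReal_ne_top, one_mul]
      _ ≤ _ := by gcongr
  unit_lt' j := by
    obtain ⟨C, hCt, hC⟩ := X.coord_le' j
    refine lt_of_le_of_lt (iSup₂_le fun x hx => ?_) hCt
    have hs : ∑ k ∈ x.support, x k * unitVec j k = x j := by
      by_cases h : x j = 0 <;> simp [unitVec, Pi.single_apply, h]
    rw [hs]
    exact (hC x).trans (by simpa using mul_le_mul_right hx C)

end SeqSpace

/-! ### The Schreier space and its 2-convexification -/

/-- A finite set of coordinates `{n₁ < … < n_k}` is admissible if `k ≤ n₁`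
(the coordinate stored at `j` is the one with number `j + 1`). -/
def Admissible (A : Finset ℕ) : Prop := ∀ j ∈ A, A.card ≤ j + 1

/-- The Schreier norm `sup_A ∑_{j ∈ A} |x_j|`, the supremum being over the admissible sets. -/
def schreierSup (x : Omega) : ℝ≥0∞ :=
  ⨆ (A : Finset ℕ) (_ : Admissible A), ∑ j ∈ A, ‖x j‖ₑ

/-- The Schreier space: the completion of the finitely supported sequences in the Schreier norm,
realized as the set of those sequences that are limits of finitely supported ones. -/
def schreierSpace : Set Omega :=
  {x | ∀ ε : ℝ≥0∞, 0 < ε → ∃ y : ℕ →₀ ℂ, schreierSup (x - y) < ε}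

open Classical in
/-- The norm of the Schreier space, with the value `∞` outside of the space. -/
def schreierNorm (x : Omega) : ℝ≥0∞ := if x ∈ schreierSpace then schreierSup x else ∞

/-- The sequence `|x|²`. -/
def absSq (x : Omega) : Omega := fun j => ((‖x j‖ ^ 2 : ℝ) : ℂ)

theorem enorm_absSq (x : Omega) (j : ℕ) : ‖absSq x j‖ₑ = ‖x j‖ₑ ^ 2 := by
  rw [absSq, ← ofReal_norm, Complex.norm_real, Real.norm_of_nonneg (by positivity),
    ENNReal.ofReal_pow (norm_nonneg _), ofReal_norm]

theorem schreierSpace_of_le {x y w : Omega} (hx : x ∈ schreierSpace) (hy : y ∈ schreierSpace)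
    {c : ℝ≥0∞} (hc : c ≠ ∞) (h : ∀ j, ‖w j‖ₑ ≤ c * (‖x j‖ₑ + ‖y j‖ₑ)) : w ∈ schreierSpace := by
  intro ε hε
  obtain ⟨ε', hε', hle, hεt⟩ : ∃ ε' : ℝ≥0∞, 0 < ε' ∧ ε' ≤ ε ∧ ε' ≠ ∞ :=
    ⟨min ε 1, by simp [hε], min_le_left _ _, ne_top_of_le_ne_top (by simp) (min_le_right _ _)⟩
  have hδ : 0 < ε' / (2 * (c + 1)) / 2 := by
    refine ENNReal.div_pos (ENNReal.div_pos hε'.ne' ?_).ne' (by simp)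
    exact ENNReal.mul_ne_top (by simp) (by simpa using hc)
  obtain ⟨x', hx'⟩ := hx _ hδ
  obtain ⟨y', hy'⟩ := hy _ hδ
  refine ⟨Finsupp.onFinset (x'.support ∪ y'.support)
    (fun j => if j ∈ x'.support ∪ y'.support then w j else 0) (by intro j; simp; tauto), ?_⟩
  refine lt_of_le_of_lt (b := c * (ε' / (2 * (c + 1)))) (iSup₂_le fun A hA => ?_) ?_
  · have h1 := (le_iSup₂_of_le (f := fun (A : Finset ℕ) (_ : Admissible A) =>
      ∑ j ∈ A, ‖(x - x') j‖ₑ) A hA le_rfl).trans hx'.le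
    have h2 := (le_iSup₂_of_le (f := fun (A : Finset ℕ) (_ : Admissible A) =>
      ∑ j ∈ A, ‖(y - y') j‖ₑ) A hA le_rfl).trans hy'.le
    have h3 := add_le_add h1 h2
    rw [ENNReal.add_halves] at h3
    refine le_trans ?_ (mul_le_mul_right h3 c)
    rw [← Finset.sum_add_distrib, Finset.mul_sum]
    refine Finset.sum_le_sum fun j _ => ?_
    by_cases hj : j ∈ x'.support ∪ y'.support
    · simp only [Pi.sub_apply, Finsupp.onFinset_apply, if_pos hj]; simp
    · have hj1 : x' j = 0 := by by_contra h0; exact hj (by simp [h0])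
      have hj2 : y' j = 0 := by by_contra h0; exact hj (by simp [h0])
      simp only [Pi.sub_apply, Finsupp.onFinset_apply, if_neg hj, hj1, hj2, sub_zero]
      exact h j
  · have hc1 : c + 1 ≠ ∞ := by simpa using hc
    calc c * (ε' / (2 * (c + 1))) ≤ (c + 1) * (ε' / (2 * (c + 1))) := by gcongr; simp
      _ = ε' / 2 := by
        rw [div_eq_mul_inv, ENNReal.mul_inv (by simp) (by simp), div_eq_mul_inv]
        rw [show (c + 1) * (ε' * (2⁻¹ * (c + 1)⁻¹)) = (ε' * 2⁻¹) * ((c + 1) * (c + 1)⁻¹) by ring,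
          ENNReal.mul_inv_cancel (by simp) hc1, mul_one]
      _ < ε' := ENNReal.half_lt_self hε'.ne' hεt
      _ ≤ ε := hle

theorem finsupp_mem_schreierSpace (x : ℕ →₀ ℂ) : (x : Omega) ∈ schreierSpace := fun ε hε =>
  ⟨x, by simpa [schreierSup] using hε⟩

theorem schreierSup_absSq_add_le (x y : Omega) :
    schreierSup (absSq (x + y)) ^ (1 / 2 : ℝ) ≤
      schreierSup (absSq x) ^ (1 / 2 : ℝ) + schreierSup (absSq y) ^ (1 / 2 : ℝ) := by
  have key : schreierSup (absSq (x + y)) ≤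
      (schreierSup (absSq x) ^ (1 / 2 : ℝ) + schreierSup (absSq y) ^ (1 / 2 : ℝ)) ^ (2 : ℝ) := by
    refine iSup₂_le fun A hA => ?_
    have hx : (∑ j ∈ A, ‖x j‖ₑ ^ (2 : ℝ)) ≤ schreierSup (absSq x) := by
      refine le_iSup₂_of_le A hA (le_of_eq (Finset.sum_congr rfl fun j _ => ?_))
      rw [enorm_absSq]; norm_cast
    have hy : (∑ j ∈ A, ‖y j‖ₑ ^ (2 : ℝ)) ≤ schreierSup (absSq y) := by
      refine le_iSup₂_of_le A hA (le_of_eq (Finset.sum_congr rfl fun j _ => ?_))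
      rw [enorm_absSq]; norm_cast
    have hm := ENNReal.Lp_add_le A (fun j => ‖x j‖ₑ) (fun j => ‖y j‖ₑ) (p := 2) (by norm_num)
    have hm2 : (∑ j ∈ A, ‖absSq (x + y) j‖ₑ) ^ (1 / 2 : ℝ) ≤
        schreierSup (absSq x) ^ (1 / 2 : ℝ) + schreierSup (absSq y) ^ (1 / 2 : ℝ) := by
      refine le_trans ?_ (hm.trans (add_le_add ?_ ?_))
      · refine ENNReal.rpow_le_rpow (Finset.sum_le_sum fun j _ => ?_) (by norm_num)
        rw [enorm_absSq]
        have : ‖(x + y) j‖ₑ ≤ ‖x j‖ₑ + ‖y j‖ₑ := enorm_add_le _ _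
        calc ‖(x + y) j‖ₑ ^ 2 = ‖(x + y) j‖ₑ ^ (2 : ℝ) := by norm_cast
          _ ≤ _ := ENNReal.rpow_le_rpow this (by norm_num)
      · exact ENNReal.rpow_le_rpow hx (by norm_num)
      · exact ENNReal.rpow_le_rpow hy (by norm_num)
    have := ENNReal.rpow_le_rpow hm2 (z := 2) (by norm_num)
    rwa [← ENNReal.rpow_mul, show (1 / 2 : ℝ) * 2 = 1 by norm_num, ENNReal.rpow_one] at this
  have := ENNReal.rpow_le_rpow key (z := 1 / 2) (by norm_num)
  rwa [← ENNReal.rpow_mul, show (2 : ℝ) * (1 / 2) = 1 by norm_num, ENNReal.rpow_one] at this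

theorem absSq_smul (c : ℂ) (x : Omega) : absSq (c • x) = ((‖c‖ ^ 2 : ℝ) : ℂ) • absSq x := by
  ext j
  simp [absSq, mul_pow]

theorem schreierSup_smul (c : ℂ) (x : Omega) : schreierSup (c • x) = ‖c‖ₑ * schreierSup x := by
  simp only [schreierSup, ENNReal.mul_iSup]
  refine iSup_congr fun A => iSup_congr fun _ => ?_
  rw [Finset.mul_sum]
  exact Finset.sum_congr rfl fun j _ => by simp [enorm_mul]

theorem smul_mem_schreierSpace (c : ℂ) {x : Omega} (hx : x ∈ schreierSpace) :
    c • x ∈ schreierSpace :=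
  schreierSpace_of_le hx (finsupp_mem_schreierSpace 0) (c := ‖c‖ₑ) enorm_ne_top
    (fun j => by simp [enorm_mul])

theorem schreierNorm_smul (c : ℂ) (x : Omega) : schreierNorm (c • x) = ‖c‖ₑ * schreierNorm x := by
  rcases eq_or_ne c 0 with rfl | hc
  · have h0 : (0 : Omega) ∈ schreierSpace := finsupp_mem_schreierSpace 0
    simp [schreierNorm, h0, schreierSup]
  · have hiff : c • x ∈ schreierSpace ↔ x ∈ schreierSpace := by
      refine ⟨fun h => ?_, smul_mem_schreierSpace c⟩
      have := smul_mem_schreierSpace c⁻¹ h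
      rwa [smul_smul, inv_mul_cancel₀ hc, one_smul] at this
    by_cases h : x ∈ schreierSpace
    · simp [schreierNorm, h, hiff, schreierSup_smul]
    · have : ‖c‖ₑ ≠ 0 := by simpa using hc
      simp [schreierNorm, h, hiff, ENNReal.mul_top this]

theorem absSq_unitVec (j : ℕ) : absSq (unitVec j) = unitVec j := by
  ext k
  by_cases hk : k = j
  · subst hk; simp [absSq, unitVec]
  · simp [absSq, unitVec, hk]

/-- The 2-convexification `𝒮²` of the Schreier space `𝒮`: the sequences `x` with `|x|² ∈ 𝒮`,
with the norm `‖ |x|² ‖_𝒮 ^ (1/2)`. -/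
def schreier2 : SeqSpace where
  toFun x := schreierNorm (absSq x) ^ (1 / 2 : ℝ)
  add_le' x y := by
    by_cases hx : absSq x ∈ schreierSpace
    · by_cases hy : absSq y ∈ schreierSpace
      · have hxy : absSq (x + y) ∈ schreierSpace := by
          refine schreierSpace_of_le hx hy (c := 2) (by simp) fun j => ?_
          simp only [enorm_absSq]
          have h1 : ‖(x + y) j‖ₑ ^ 2 ≤ (‖x j‖ₑ + ‖y j‖ₑ) ^ 2 := by
            gcongr; exact enorm_add_le _ _
          refine h1.trans ?_
          have h2 := ENNReal.rpow_add_le_mul_rpow_add_rpow ‖x j‖ₑ ‖y j‖ₑ (p := 2) (by norm_num)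
          have h3 : (2 : ℝ) - 1 = 1 := by norm_num
          rw [h3, ENNReal.rpow_one] at h2
          exact_mod_cast h2
        simpa [schreierNorm, hx, hy, hxy] using schreierSup_absSq_add_le x y
      · simp [schreierNorm, hy]
    · simp [schreierNorm, hx]
  smul' c x := by
    rw [absSq_smul, schreierNorm_smul, ENNReal.mul_rpow_of_nonneg _ _ (by norm_num)]
    congr 1
    rw [← ofReal_norm, Complex.norm_real, Real.norm_of_nonneg (by positivity),
      ENNReal.ofReal_rpow_of_nonneg (by positivity) (by norm_num), ← Real.sqrt_eq_rpow,
      Real.sqrt_sq (norm_nonneg _), ofReal_norm]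
  coord_le' j := by
    refine ⟨1, by simp, fun x => ?_⟩
    rw [one_mul]
    by_cases hx : absSq x ∈ schreierSpace
    · simp only [schreierNorm, hx, if_true]
      have hA : Admissible {j} := by intro k _; simp
      have h1 : ‖x j‖ₑ ^ (2 : ℝ) ≤ schreierSup (absSq x) := by
        refine le_iSup₂_of_le {j} hA ?_
        simp [enorm_absSq]
      have := ENNReal.rpow_le_rpow h1 (z := 1 / 2) (by norm_num)
      rwa [← ENNReal.rpow_mul, show (2 : ℝ) * (1 / 2) = 1 by norm_num, ENNReal.rpow_one] at this
    · simp [schreierNorm, hx]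
  unit_lt' j := by
    have hmem : unitVec j ∈ schreierSpace := by
      have := finsupp_mem_schreierSpace (Finsupp.single j 1)
      rwa [show ((Finsupp.single j 1 : ℕ →₀ ℂ) : Omega) = unitVec j from
        Finsupp.single_eq_pi_single j 1] at this
    rw [absSq_unitVec]
    simp only [schreierNorm, hmem, if_true]
    refine ENNReal.rpow_lt_top_of_nonneg (by norm_num) (ne_of_lt ?_)
    refine lt_of_le_of_lt (b := 1) (iSup₂_le fun A _ => ?_) (by simp)
    have hk : ∀ k, ‖unitVec j k‖ₑ = if j = k then 1 else 0 := by
      intro k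
      by_cases h : j = k
      · subst h; simp [unitVec]
      · simp [unitVec, h, Ne.symm h]
    simp only [hk, Finset.sum_ite_eq]
    split_ifs <;> simp

/-! ### Complex interpolation and the derived space -/

/-- The closed strip `0 ≤ Re z ≤ 1`. -/
def closedStrip : Set ℂ := {z | 0 ≤ z.re ∧ z.re ≤ 1}

/-- The open strip `0 < Re z < 1`. -/
def openStrip : Set ℂ := {z | 0 < z.re ∧ z.re < 1}

/-- `t ↦ f t` is a bounded and continuous function from `ℝ` to the normed space `X`. -/
def BoundedContinuousInto (X : SeqSpace) (f : ℝ → Omega) : Prop :=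
  (∃ C : ℝ≥0∞, C < ∞ ∧ ∀ t, X (f t) ≤ C) ∧
    ∀ t, Tendsto (fun s => X (f s - f t)) (𝓝 t) (𝓝 0)

theorem BoundedContinuousInto.add {X : SeqSpace} {f g : ℝ → Omega}
    (hf : BoundedContinuousInto X f) (hg : BoundedContinuousInto X g) :
    BoundedContinuousInto X (f + g) := by
  obtain ⟨⟨C, hC, hfC⟩, hf⟩ := hf
  obtain ⟨⟨D, hD, hgD⟩, hg⟩ := hg
  refine ⟨⟨C + D, ENNReal.add_lt_top.2 ⟨hC, hD⟩, fun t =>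
    (X.add_le' _ _).trans (add_le_add (hfC t) (hgD t))⟩, fun t => ?_⟩
  have h := (hf t).add (hg t)
  rw [add_zero] at h
  refine tendsto_of_tendsto_of_tendsto_of_le_of_le tendsto_const_nhds h (fun _ => zero_le) ?_
  intro s
  have : (f + g) s - (f + g) t = (f s - f t) + (g s - g t) := by
    simp only [Pi.add_apply]; abel
  simp only [this]
  exact X.add_le' _ _

theorem BoundedContinuousInto.smul {X : SeqSpace} {f : ℝ → Omega} (c : ℂ)
    (hf : BoundedContinuousInto X f) : BoundedContinuousInto X (c • f) := by
  obtain ⟨⟨C, hC, hfC⟩, hf⟩ := hf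
  refine ⟨⟨‖c‖ₑ * C, ENNReal.mul_lt_top enorm_lt_top hC, fun t => ?_⟩, fun t => ?_⟩
  · rw [Pi.smul_apply, X.smul']
    gcongr
    exact hfC t
  · have h := ENNReal.Tendsto.const_mul (hf t) (a := ‖c‖ₑ) (Or.inr enorm_ne_top)
    rw [mul_zero] at h
    refine h.congr fun s => ?_
    rw [Pi.smul_apply, Pi.smul_apply, ← smul_sub, X.smul']

theorem BoundedContinuousInto.zero (X : SeqSpace) : BoundedContinuousInto X 0 :=
  ⟨⟨0, by simp, fun _ => by simp [X.map_zero]⟩, fun _ => by simp [X.map_zero]⟩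

/-- The space `𝓕_∞(X₀, X₁)` of the functions `F` from the closed strip to `ω` that are bounded
and continuous on the closed strip and analytic on the open strip (for the topology of pointwise
convergence of `ω`, so coordinatewise), and for which `t ↦ F(j + it)` is a bounded and continuous
function into `X_j`, `j = 0, 1`. The values of `F` outside of the closed strip play no role. -/
def calderonSpace (X₀ X₁ : SeqSpace) : Submodule ℂ (ℂ → Omega) where
  carrier := {F |
    (∀ j, ContinuousOn (fun z => F z j) closedStrip) ∧
    (∀ j, ∃ C : ℝ, ∀ z ∈ closedStrip, ‖F z j‖ ≤ C) ∧
    (∀ j, DifferentiableOn ℂ (fun z => F z j) openStrip) ∧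
    BoundedContinuousInto X₀ (fun t => F (t * Complex.I)) ∧
    BoundedContinuousInto X₁ (fun t => F (1 + t * Complex.I))}
  add_mem' := by
    rintro F G ⟨h1, h2, h3, h4, h5⟩ ⟨k1, k2, k3, k4, k5⟩
    refine ⟨fun j => (h1 j).add (k1 j), fun j => ?_, fun j => (h3 j).add (k3 j), h4.add k4,
      h5.add k5⟩
    obtain ⟨C, hC⟩ := h2 j
    obtain ⟨D, hD⟩ := k2 j
    exact ⟨C + D, fun z hz => (norm_add_le _ _).trans (add_le_add (hC z hz) (hD z hz))⟩
  zero_mem' := ⟨fun _ => continuousOn_const, fun _ => ⟨0, by simp⟩,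
    fun _ => differentiableOn_const _, .zero _, .zero _⟩
  smul_mem' := by
    rintro c F ⟨h1, h2, h3, h4, h5⟩
    refine ⟨fun j => (h1 j).const_smul c, fun j => ?_, fun j => (h3 j).const_smul c, h4.smul c,
      h5.smul c⟩
    obtain ⟨C, hC⟩ := h2 j
    refine ⟨‖c‖ * C, fun z hz => ?_⟩
    simp only [Pi.smul_apply, smul_eq_mul, norm_mul]
    gcongr
    exact hC z hz

/-- The norm `max (sup_t ‖F(it)‖_{X₀}, sup_t ‖F(1 + it)‖_{X₁})` of `𝓕_∞(X₀, X₁)`. -/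
def calderonNorm (X₀ X₁ : SeqSpace) (F : ℂ → Omega) : ℝ≥0∞ :=
  max (⨆ t : ℝ, X₀ (F (t * Complex.I))) (⨆ t : ℝ, X₁ (F (1 + t * Complex.I)))

/-- The functions `F ∈ 𝓕_∞(X₀, X₁)` with `F(1/2) = y` and `F'(1/2) = x`, where `p = (x, y)`. -/
def calderonLifts (X₀ X₁ : SeqSpace) (p : Omega × Omega) : Set (ℂ → Omega) :=
  {F | F ∈ calderonSpace X₀ X₁ ∧ F (1 / 2) = p.2 ∧
    ∀ j, deriv (fun z => F z j) (1 / 2) = p.1 j}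

/-- The norm of the derived space of `(X₀, X₁)_{1/2}`:
`‖(x, y)‖ = inf {‖F‖ : F(1/2) = y, F'(1/2) = x}`, which is `∞` if there is no such `F`. -/
def derivedNorm (X₀ X₁ : SeqSpace) (p : Omega × Omega) : ℝ≥0∞ :=
  ⨅ F : calderonLifts X₀ X₁ p, calderonNorm X₀ X₁ F

theorem half_mem_openStrip : (1 / 2 : ℂ) ∈ openStrip := by
  constructor <;> norm_num

theorem isOpen_openStrip : IsOpen openStrip :=
  (isOpen_lt continuous_const Complex.continuous_re).inter
    (isOpen_lt Complex.continuous_re continuous_const)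

section derived

variable {X₀ X₁ : SeqSpace}

theorem differentiableAt_half {F : ℂ → Omega} (hF : F ∈ calderonSpace X₀ X₁) (j : ℕ) :
    DifferentiableAt ℂ (fun z => F z j) (1 / 2) :=
  (hF.2.2.1 j).differentiableAt (isOpen_openStrip.mem_nhds half_mem_openStrip)

theorem calderonNorm_add_le (F G : ℂ → Omega) :
    calderonNorm X₀ X₁ (F + G) ≤ calderonNorm X₀ X₁ F + calderonNorm X₀ X₁ G := by
  refine max_le (iSup_le fun t => ?_) (iSup_le fun t => ?_)
  · refine (X₀.add_le' _ _).trans (add_le_add ?_ ?_)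
    · exact le_max_of_le_left (le_iSup_of_le t le_rfl)
    · exact le_max_of_le_left (le_iSup_of_le t le_rfl)
  · refine (X₁.add_le' _ _).trans (add_le_add ?_ ?_)
    · exact le_max_of_le_right (le_iSup_of_le t le_rfl)
    · exact le_max_of_le_right (le_iSup_of_le t le_rfl)

theorem calderonNorm_smul_le (c : ℂ) (F : ℂ → Omega) :
    calderonNorm X₀ X₁ (c • F) ≤ ‖c‖ₑ * calderonNorm X₀ X₁ F := by
  refine max_le (iSup_le fun t => ?_) (iSup_le fun t => ?_)
  · rw [Pi.smul_apply, X₀.smul']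
    gcongr
    exact le_max_of_le_left (le_iSup_of_le t le_rfl)
  · rw [Pi.smul_apply, X₁.smul']
    gcongr
    exact le_max_of_le_right (le_iSup_of_le t le_rfl)

theorem calderonNorm_lt_top {F : ℂ → Omega} (hF : F ∈ calderonSpace X₀ X₁) :
    calderonNorm X₀ X₁ F < ∞ := by
  obtain ⟨-, -, -, ⟨⟨C, hC, h1⟩, -⟩, ⟨D, hD, h2⟩, -⟩ := hF
  exact max_lt ((iSup_le h1).trans_lt hC) ((iSup_le h2).trans_lt hD)

theorem add_mem_calderonLifts {F G : ℂ → Omega} {p q : Omega × Omega}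
    (hF : F ∈ calderonLifts X₀ X₁ p) (hG : G ∈ calderonLifts X₀ X₁ q) :
    F + G ∈ calderonLifts X₀ X₁ (p + q) := by
  refine ⟨add_mem hF.1 hG.1, by rw [Pi.add_apply, hF.2.1, hG.2.1]; rfl, fun j => ?_⟩
  have := deriv_fun_add (differentiableAt_half hF.1 j) (differentiableAt_half hG.1 j)
  simp only [Pi.add_apply, Prod.fst_add]
  rw [this, hF.2.2, hG.2.2]

theorem smul_mem_calderonLifts (c : ℂ) {F : ℂ → Omega} {p : Omega × Omega}
    (hF : F ∈ calderonLifts X₀ X₁ p) : c • F ∈ calderonLifts X₀ X₁ (c • p) := by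
  refine ⟨Submodule.smul_mem _ c hF.1, by rw [Pi.smul_apply, hF.2.1]; rfl, fun j => ?_⟩
  have := deriv_fun_const_smul c (differentiableAt_half hF.1 j)
  simp only [Pi.smul_apply, Prod.smul_fst]
  rw [this, hF.2.2]

theorem derivedNorm_add_le (p q : Omega × Omega) :
    derivedNorm X₀ X₁ (p + q) ≤ derivedNorm X₀ X₁ p + derivedNorm X₀ X₁ q := by
  simp only [derivedNorm, ENNReal.iInf_add, ENNReal.add_iInf]
  refine le_iInf fun G => le_iInf fun F => ?_
  exact iInf_le_of_le ⟨_, add_mem_calderonLifts F.2 G.2⟩ (calderonNorm_add_le _ _)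

theorem derivedNorm_zero : derivedNorm X₀ X₁ 0 = 0 := by
  refine le_antisymm (iInf_le_of_le ⟨0, zero_mem _, by simp, by simp⟩ ?_) zero_le
  simp [calderonNorm, SeqSpace.map_zero]

theorem derivedNorm_smul_le (c : ℂ) (p : Omega × Omega) :
    derivedNorm X₀ X₁ (c • p) ≤ ‖c‖ₑ * derivedNorm X₀ X₁ p := by
  rcases eq_or_ne c 0 with rfl | hc
  · simp [derivedNorm_zero]
  · simp only [derivedNorm]
    rw [ENNReal.mul_iInf_of_ne (by simpa using hc) enorm_ne_top]
    exact le_iInf fun F => iInf_le_of_le ⟨_, smul_mem_calderonLifts c F.2⟩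
      (calderonNorm_smul_le _ _)

theorem derivedNorm_smul (c : ℂ) (p : Omega × Omega) :
    derivedNorm X₀ X₁ (c • p) = ‖c‖ₑ * derivedNorm X₀ X₁ p := by
  rcases eq_or_ne c 0 with rfl | hc
  · simp [derivedNorm_zero]
  · refine le_antisymm (derivedNorm_smul_le c p) ?_
    have h := derivedNorm_smul_le (X₀ := X₀) (X₁ := X₁) c⁻¹ (c • p)
    rw [smul_smul, inv_mul_cancel₀ hc, one_smul] at h
    calc ‖c‖ₑ * derivedNorm X₀ X₁ p ≤ ‖c‖ₑ * (‖c⁻¹‖ₑ * derivedNorm X₀ X₁ (c • p)) := by gcongr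
      _ = _ := by rw [← mul_assoc, ← enorm_mul, mul_inv_cancel₀ hc, enorm_one, one_mul]

theorem eq_zero_of_derivedNorm (p : Omega × Omega) (h : derivedNorm X₀ X₁ p = 0) : p = 0 := by
  -- every coordinate functional is bounded, by the maximum principle on the strip
  have key : ∀ j, ∃ C : ℝ, 0 ≤ C ∧ ∀ F ∈ calderonLifts X₀ X₁ p, ∀ M : ℝ, 0 ≤ M →
      calderonNorm X₀ X₁ F ≤ ENNReal.ofReal M → ‖p.2 j‖ ≤ C * M ∧ ‖p.1 j‖ ≤ 4 * (C * M) := by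
    intro j
    obtain ⟨C₀, hC₀, h₀⟩ := X₀.coord_le' j
    obtain ⟨C₁, hC₁, h₁⟩ := X₁.coord_le' j
    set C := max C₀.toReal C₁.toReal with hCdef
    have hC : 0 ≤ C := le_max_of_le_left ENNReal.toReal_nonneg
    refine ⟨C, hC, fun F hF M hM hFM => ?_⟩
    have hb0 : ∀ z : ℂ, z.re = 0 → ‖F z j‖ ≤ C * M := by
      intro z hz
      have hz' : z = (z.im : ℂ) * Complex.I := by apply Complex.ext <;> simp [hz]
      have h2 : X₀ (F z) ≤ ENNReal.ofReal M := by
        refine le_trans ?_ hFM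
        refine le_max_of_le_left (le_iSup_of_le z.im ?_)
        rw [← hz']
      have h3 := (h₀ (F z)).trans (mul_le_mul_right h2 C₀)
      have h4 := ENNReal.toReal_mono (ENNReal.mul_lt_top hC₀ ENNReal.ofReal_lt_top).ne h3
      rw [ENNReal.toReal_mul, ENNReal.toReal_ofReal hM, toReal_enorm] at h4
      exact h4.trans (by gcongr; exact le_max_left _ _)
    have hb1 : ∀ z : ℂ, z.re = 1 → ‖F z j‖ ≤ C * M := by
      intro z hz
      have hz' : z = 1 + (z.im : ℂ) * Complex.I := by apply Complex.ext <;> simp [hz]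
      have h2 : X₁ (F z) ≤ ENNReal.ofReal M := by
        refine le_trans ?_ hFM
        refine le_max_of_le_right (le_iSup_of_le z.im ?_)
        rw [← hz']
      have h3 := (h₁ (F z)).trans (mul_le_mul_right h2 C₁)
      have h4 := ENNReal.toReal_mono (ENNReal.mul_lt_top hC₁ ENNReal.ofReal_lt_top).ne h3
      rw [ENNReal.toReal_mul, ENNReal.toReal_ofReal hM, toReal_enorm] at h4
      exact h4.trans (by gcongr; exact le_max_right _ _)
    obtain ⟨⟨hcont, hbdd, hdiff, -, -⟩, hF2, hF1⟩ := hF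
    obtain ⟨B, hB⟩ := hbdd j
    have hcl : closure (Complex.re ⁻¹' Ioo 0 1) = closedStrip := by
      rw [Complex.closure_preimage_re, closure_Ioo (by norm_num)]; rfl
    have hdc : DiffContOnCl ℂ (fun z => F z j) (Complex.re ⁻¹' Ioo 0 1) :=
      ⟨hdiff j, by rw [hcl]; exact hcont j⟩
    have hstrip : ∀ z : ℂ, 0 ≤ z.re → z.re ≤ 1 → ‖F z j‖ ≤ C * M := by
      intro z hz0 hz1
      refine PhragmenLindelof.vertical_strip hdc ⟨0, by simpa using Real.pi_pos, 0, ?_⟩ hb0 hb1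
        hz0 hz1
      refine Asymptotics.IsBigO.of_bound B ?_
      filter_upwards [mem_inf_of_right (mem_principal_self _)] with w hw
      simpa using hB w ⟨hw.1.le, hw.2.le⟩
    refine ⟨?_, ?_⟩
    · rw [← hF2]; exact hstrip _ (by norm_num) (by norm_num)
    · rw [← hF1 j]
      have hsub : ∀ z ∈ Metric.closedBall (1 / 2 : ℂ) (1 / 4), 0 < z.re ∧ z.re < 1 := by
        intro z hz
        have h5 : |(z - 1 / 2).re| ≤ 1 / 4 :=
          (Complex.abs_re_le_norm _).trans (by simpa [dist_eq_norm] using hz)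
        have h6 : (z - 1 / 2).re = z.re - 1 / 2 := by simp
        rw [h6, abs_le] at h5
        constructor <;> linarith [h5.1, h5.2]
      have hd : DiffContOnCl ℂ (fun z => F z j) (Metric.ball (1 / 2) (1 / 4)) := by
        refine DifferentiableOn.diffContOnCl ?_
        rw [closure_ball _ (by norm_num)]
        exact (hdiff j).mono fun z hz => hsub z hz
      have := Complex.norm_deriv_le_of_forall_mem_sphere_norm_le (c := (1 / 2 : ℂ)) (R := 1 / 4)
        (C := C * M) (by norm_num) hd fun z hz =>
          have hz' := hsub z (Metric.sphere_subset_closedBall hz)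
          hstrip z hz'.1.le hz'.2.le
      linarith
  have hsmall : ∀ j, ∀ ε : ℝ, 0 < ε → ‖p.2 j‖ ≤ ε ∧ ‖p.1 j‖ ≤ ε := by
    intro j ε hε
    obtain ⟨C, hC, hk⟩ := key j
    set M := ε / (4 * (C + 1)) with hMdef
    have hM : 0 < M := by positivity
    have hlt : derivedNorm X₀ X₁ p < ENNReal.ofReal M := by rw [h]; simpa using hM
    obtain ⟨F, hF⟩ := iInf_lt_iff.1 hlt
    obtain ⟨ha, hb⟩ := hk F F.2 M hM.le hF.le
    have h4 : 4 * (C * M) ≤ ε := by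
      have : 4 * ((C + 1) * M) = ε := by rw [hMdef]; field_simp
      nlinarith
    exact ⟨ha.trans (by nlinarith [mul_nonneg hC hM.le]), hb.trans h4⟩
  ext j
  · exact norm_le_zero_iff.1 (le_of_forall_pos_le_add fun ε hε => by simpa using (hsmall j ε hε).2)
  · exact norm_le_zero_iff.1 (le_of_forall_pos_le_add fun ε hε => by simpa using (hsmall j ε hε).1)

theorem smul_unitVec_mem_calderonSpace (j : ℕ) (g : ℂ → ℂ) (hc : ContinuousOn g closedStrip)
    (hb : ∃ C : ℝ, ∀ z ∈ closedStrip, ‖g z‖ ≤ C) (hd : DifferentiableOn ℂ g openStrip) :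
    (fun z => g z • unitVec j) ∈ calderonSpace X₀ X₁ := by
  obtain ⟨C, hC⟩ := hb
  have aux : ∀ (X : SeqSpace) (φ : ℝ → ℂ), Continuous φ → (∀ t, φ t ∈ closedStrip) →
      BoundedContinuousInto X (fun t => g (φ t) • unitVec j) := by
    intro X φ hφ hm
    refine ⟨⟨ENNReal.ofReal C * X (unitVec j),
      ENNReal.mul_lt_top ENNReal.ofReal_lt_top (X.unit_lt' j), fun t => ?_⟩, fun t => ?_⟩
    · rw [X.smul', ← ofReal_norm]
      gcongr
      exact hC _ (hm t)
    · have hcont : Continuous fun t => g (φ t) := hc.comp_continuous hφ hm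
      have h1 : Tendsto (fun s => ‖g (φ s) - g (φ t)‖ₑ) (𝓝 t) (𝓝 0) := by
        have : Continuous fun s => ‖g (φ s) - g (φ t)‖ₑ := (hcont.sub continuous_const).enorm
        simpa using this.tendsto t
      have h2 := ENNReal.Tendsto.mul_const h1 (b := X (unitVec j)) (Or.inr (X.unit_lt' j).ne)
      rw [zero_mul] at h2
      refine h2.congr fun s => ?_
      rw [← sub_smul, X.smul']
  refine ⟨fun k => ?_, fun k => ⟨C * ‖unitVec j k‖, fun z hz => ?_⟩, fun k => ?_,
    aux X₀ _ (by fun_prop) fun t => ?_, aux X₁ _ (by fun_prop) fun t => ?_⟩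
  · exact hc.mul continuousOn_const
  · simp only [Pi.smul_apply, smul_eq_mul, norm_mul]
    gcongr
    exact hC z hz
  · exact hd.mul (differentiableOn_const _)
  · simp [closedStrip]
  · simp [closedStrip]

theorem derivedNorm_unitVec_right (j : ℕ) : derivedNorm X₀ X₁ (0, unitVec j) < ∞ := by
  have hF : (fun z => (fun _ => 1 : ℂ → ℂ) z • unitVec j) ∈ calderonSpace X₀ X₁ :=
    smul_unitVec_mem_calderonSpace j _ continuousOn_const ⟨1, by simp⟩
      (differentiableOn_const _)
  exact (iInf_le_of_le (⟨_, hF, by simp, fun k => by simp⟩ :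
    calderonLifts X₀ X₁ (0, unitVec j)) le_rfl).trans_lt (calderonNorm_lt_top hF)

theorem derivedNorm_unitVec_left (j : ℕ) : derivedNorm X₀ X₁ (unitVec j, 0) < ∞ := by
  let g : ℂ → ℂ := fun z => 3 / 2 * ((z - 1 / 2) / (z + 1))
  have hne : ∀ z : ℂ, 0 ≤ z.re → z + 1 ≠ 0 := by
    intro z hz h0
    have := congrArg Complex.re h0
    simp at this
    linarith
  have hd : ∀ z : ℂ, 0 ≤ z.re → DifferentiableAt ℂ g z := by
    intro z hz
    have := hne z hz
    fun_prop (disch := assumption)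
  have hF : (fun z => g z • unitVec j) ∈ calderonSpace X₀ X₁ := by
    refine smul_unitVec_mem_calderonSpace j g
      (fun z hz => (hd z hz.1).continuousAt.continuousWithinAt) ⟨3 / 2, fun z hz => ?_⟩
      (fun z hz => (hd z hz.1.le).differentiableWithinAt)
    have h1 : ‖z - 1 / 2‖ ≤ ‖z + 1‖ := by
      rw [Complex.norm_def, Complex.norm_def]
      refine Real.sqrt_le_sqrt ?_
      simp [Complex.normSq_apply]
      nlinarith [hz.1]
    have h2 : ‖(z - 1 / 2) / (z + 1)‖ ≤ 1 := by
      rw [norm_div]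
      exact div_le_one_of_le₀ h1 (norm_nonneg _)
    have h3 : ‖(3 / 2 : ℂ)‖ = 3 / 2 := by norm_num
    simp only [g]
    rw [norm_mul, h3]
    linarith
  have hder : HasDerivAt g 1 (1 / 2) := by
    have h1 : HasDerivAt (fun z : ℂ => z - 1 / 2) 1 (1 / 2) := (hasDerivAt_id _).sub_const _
    have h2 : HasDerivAt (fun z : ℂ => z + 1) 1 (1 / 2) := (hasDerivAt_id _).add_const _
    have h3 := ((h1.div h2 (by norm_num)).const_mul (3 / 2 : ℂ))
    have h4 : (3 / 2 * ((1 * (1 / 2 + 1) - (1 / 2 - 1 / 2) * 1) / (1 / 2 + 1) ^ 2) : ℂ) = 1 := by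
      norm_num
    rw [h4] at h3
    exact h3
  refine (iInf_le_of_le (⟨_, hF, ?_, fun k => ?_⟩ :
    calderonLifts X₀ X₁ (unitVec j, 0)) le_rfl).trans_lt (calderonNorm_lt_top hF)
  · simp [g]
  · have := (hder.mul_const (unitVec j k)).deriv
    simpa using this

end derived

/-- The couples `(x, y) ∈ ω × ω` whose norm in the derived space of `(X, X*)_{1/2}` is finite. -/
def derivedSubmodule (X : SeqSpace) : Submodule ℂ (Omega × Omega) where
  carrier := {p | derivedNorm X X.dual p < ∞}
  add_mem' hp hq := (derivedNorm_add_le _ _).trans_lt (ENNReal.add_lt_top.2 ⟨hp, hq⟩)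
  zero_mem' := by simp [derivedNorm_zero]
  smul_mem' c p hp := (derivedNorm_smul_le c p).trans_lt (ENNReal.mul_lt_top enorm_lt_top hp)

/-- The derived space `Z(X)` of `(X, X*)_{1/2}`, with the norm
`‖(x, y)‖ = inf {‖F‖ : F ∈ 𝓕_∞(X, X*), F(1/2) = y, F'(1/2) = x}`. -/
def DerivedSpace (X : SeqSpace) : Type := derivedSubmodule X

namespace DerivedSpace

variable (X : SeqSpace)

instance : AddCommGroup (DerivedSpace X) := inferInstanceAs (AddCommGroup (derivedSubmodule X))

instance : Module ℂ (DerivedSpace X) := inferInstanceAs (Module ℂ (derivedSubmodule X))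

instance : Norm (DerivedSpace X) := ⟨fun p => (derivedNorm X X.dual p.1).toReal⟩

theorem normCore : NormedSpace.Core ℂ (DerivedSpace X) where
  norm_nonneg _ := ENNReal.toReal_nonneg
  norm_smul c p := by
    have h : derivedNorm X X.dual (c • p).1 = ‖c‖ₑ * derivedNorm X X.dual p.1 :=
      derivedNorm_smul c p.1
    change (derivedNorm X X.dual (c • p).1).toReal = ‖c‖ * (derivedNorm X X.dual p.1).toReal
    rw [h, ENNReal.toReal_mul, toReal_enorm]
  norm_triangle p q := by
    have h : derivedNorm X X.dual (p + q).1
        ≤ derivedNorm X X.dual p.1 + derivedNorm X X.dual q.1 := derivedNorm_add_le p.1 q.1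
    change (derivedNorm X X.dual (p + q).1).toReal
      ≤ (derivedNorm X X.dual p.1).toReal + (derivedNorm X X.dual q.1).toReal
    rw [← ENNReal.toReal_add (ne_of_lt p.2) (ne_of_lt q.2)]
    exact ENNReal.toReal_mono (ENNReal.add_lt_top.2 ⟨p.2, q.2⟩).ne h
  norm_eq_zero_iff p := by
    change (derivedNorm X X.dual p.1).toReal = 0 ↔ p = 0
    constructor
    · intro h
      have h0 : derivedNorm X X.dual p.1 = 0 :=
        ((ENNReal.toReal_eq_zero_iff _).1 h).resolve_right (ne_of_lt p.2)
      exact Subtype.ext (eq_zero_of_derivedNorm p.1 h0)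
    · rintro rfl
      have : derivedNorm X X.dual (0 : DerivedSpace X).1 = 0 := derivedNorm_zero
      rw [this, ENNReal.toReal_zero]

instance : NormedAddCommGroup (DerivedSpace X) := NormedAddCommGroup.ofCore (normCore X)

instance : NormedSpace ℂ (DerivedSpace X) := NormedSpace.ofCore (normCore X)

/-- The natural basis `v₁ = (e₁, 0), v₂ = (0, e₁), v₃ = (e₂, 0), v₄ = (0, e₂), …` of `Z(X)`;
`natBasis X j` is the vector `v_{j+1}`. -/
def natBasis (j : ℕ) : DerivedSpace X :=
  if Even j then ⟨(unitVec (j / 2), 0), derivedNorm_unitVec_left _⟩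
  else ⟨(0, unitVec (j / 2)), derivedNorm_unitVec_right _⟩

end DerivedSpace

/-! ### The `E(n, m, K)`-property -/

/-- The finite families `u` and `w` are `K`-equivalent:
`K⁻¹ ‖∑ a_j w_j‖ ≤ ‖∑ a_j u_j‖ ≤ K ‖∑ a_j w_j‖` for all scalars `a_j`. -/
def KEquivalent {ι E G : Type*} [Fintype ι] [NormedAddCommGroup E] [NormedSpace ℂ E]
    [NormedAddCommGroup G] [NormedSpace ℂ G] (K : ℝ) (u : ι → E) (w : ι → G) : Prop :=
  ∀ a : ι → ℂ, K⁻¹ * ‖∑ j, a j • w j‖ ≤ ‖∑ j, a j • u j‖ ∧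
    ‖∑ j, a j • u j‖ ≤ K * ‖∑ j, a j • w j‖

/-- The family `(e_j)_{j ∈ J}` is `(m, K)`-euclidean: for every `A ⊆ J` with `|A| ≤ m`, the family
`(e_j)_{j ∈ A}` is `K`-equivalent to the unit vector basis of `ℓ₂^{|A|}`. -/
def IsEuclidean {E : Type*} [NormedAddCommGroup E] [NormedSpace ℂ E]
    (e : ℕ → E) (J : Set ℕ) (m : ℕ) (K : ℝ) : Prop :=
  ∀ A : Finset ℕ, (A : Set ℕ) ⊆ J → A.card ≤ m →
    KEquivalent K (fun j : A => e j) (fun j : A => EuclideanSpace.single j (1 : ℂ))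

/-- The sequence `e` has the `E(n, m, K)`-property: there is a set `I` of indices with `|I| = n` such
that `(e_j)_{j ∉ I}` is `(m, K)`-euclidean. -/
def HasEProperty {E : Type*} [NormedAddCommGroup E] [NormedSpace ℂ E]
    (e : ℕ → E) (n m : ℕ) (K : ℝ) : Prop :=
  ∃ I : Finset ℕ, I.card = n ∧ IsEuclidean e ((I : Set ℕ)ᶜ) m K

end

/-! The Schreier condition is vacuous on few coordinates that lie far out. If `B` has at most `n`
elements, all stored at places `≥ n / 2`, then `B` is a union of two admissible sets, so the norm of
𝒮² of a vector supported in `B` agrees with its ℓ₂ norm up to the factor √2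
(`sum_sq_le_two_mul_schreier2_sq`, `schreier2_sq_le_sum_sq`). By duality the same holds for (𝒮²)*
(`dual_schreier2_sq_le`, `sum_sq_le_dual_schreier2_sq`). On `B` both ends of the interpolation
couple are thus a single Hilbert space, up to a constant independent of `n`, and a derived space of
such a couple is just ℓ₂ ⊕ ℓ₂.

The upper estimate comes from an explicit lift: each basis vector lifts to a scalar function,
bounded by 3/2, times a unit vector, and the lifts are combined linearly
(`derivedNorm_sum_natBasis_le`). For the lower estimate any lift is restricted to the coordinates in
`B`. As a function with Euclidean values it is bounded on the strip by the three lines principle,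
which controls its value at 1/2, and Cauchy's inequality controls its derivative there
(`sum_sq_le_of_mem_calderonLifts`).

Leaving out the first `n` basis vectors puts the coordinates `j / 2` of the remaining ones in the
range where all this applies. -/

/-! ### 𝒮² and its dual on few coordinates far out -/

theorem sum_enorm_sq (B : Finset ℕ) (x : Omega) :
    ∑ j ∈ B, ‖x j‖ₑ ^ 2 = ENNReal.ofReal (∑ j ∈ B, ‖x j‖ ^ 2) := by
  rw [ENNReal.ofReal_sum_of_nonneg fun _ _ => by positivity]
  refine Finset.sum_congr rfl fun j _ => ?_
  rw [ENNReal.ofReal_pow (norm_nonneg _), ofReal_norm]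

theorem schreier2_sq (x : Omega) : schreier2 x ^ 2 = schreierNorm (absSq x) := by
  change (schreierNorm (absSq x) ^ (1 / 2 : ℝ)) ^ 2 = _
  rw [← ENNReal.rpow_natCast, ← ENNReal.rpow_mul]
  norm_num

/-- Outside of the Schreier space the norm is `∞`, so lower estimates of the norm need no
membership. -/
theorem schreierSup_le_schreierNorm (x : Omega) : schreierSup x ≤ schreierNorm x := by
  unfold schreierNorm
  split_ifs <;> simp

theorem sum_sq_le_schreier2_sq {A : Finset ℕ} (hA : Admissible A) (x : Omega) :
    ∑ j ∈ A, ‖x j‖ₑ ^ 2 ≤ schreier2 x ^ 2 := by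
  rw [schreier2_sq]
  refine le_trans ?_ (schreierSup_le_schreierNorm _)
  refine le_iSup₂_of_le A hA (le_of_eq (Finset.sum_congr rfl fun j _ => ?_))
  rw [enorm_absSq]

/-- A set of at most `n` coordinates beyond the first `n / 2` ones is a union of two admissible
sets. -/
theorem sum_sq_le_two_mul_schreier2_sq {n : ℕ} {B : Finset ℕ} (hcard : B.card ≤ n)
    (hB : ∀ j ∈ B, n / 2 ≤ j) (x : Omega) :
    ∑ j ∈ B, ‖x j‖ₑ ^ 2 ≤ 2 * schreier2 x ^ 2 := by
  -- Cut `B` into halves. The larger has ⌈|B|/2⌉ ≤ ⌊n/2⌋ + 1 elements, and this is admissible only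
  -- because the coordinate stored at `j ≥ n / 2` has number `j + 1`.
  obtain ⟨B₁, hsub, h₁⟩ := Finset.exists_subset_card_eq (s := B) (n := B.card / 2) (by omega)
  have h₂ : (B \ B₁).card = B.card - B.card / 2 := by rw [Finset.card_sdiff_of_subset hsub, h₁]
  rw [← Finset.sum_sdiff hsub, two_mul]
  refine add_le_add (sum_sq_le_schreier2_sq (fun j hj => ?_) x)
    (sum_sq_le_schreier2_sq (fun j hj => ?_) x)
  · have := hB j (Finset.sdiff_subset hj)
    omega
  · have := hB j (hsub hj)
    omega

/-- An admissible set sees no more than the whole support, so `B` may be any finite set. Finiteness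
of the support also gives the membership in the Schreier space, without which the norm would be `∞`.
-/
theorem schreier2_sq_le_sum_sq {B : Finset ℕ} {x : Omega} (hx : ∀ j ∉ B, x j = 0) :
    schreier2 x ^ 2 ≤ ∑ j ∈ B, ‖x j‖ₑ ^ 2 := by
  have hmem : absSq x ∈ schreierSpace := by
    have h := finsupp_mem_schreierSpace (Finsupp.onFinset B (absSq x) fun j hj => by
      by_contra hjB
      exact hj (by simp [absSq, hx j hjB]))
    rwa [Finsupp.coe_onFinset] at h
  rw [schreier2_sq, schreierNorm, if_pos hmem]
  refine iSup₂_le fun A _ => ?_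
  simp only [enorm_absSq]
  refine Finset.sum_le_sum_of_ne_zero fun j _ hj => ?_
  by_contra hjB
  exact hj (by simp [hx j hjB])

theorem enorm_sum_mul_sq_le (B : Finset ℕ) (x y : Omega) :
    ‖∑ j ∈ B, x j * y j‖ₑ ^ 2 ≤ (∑ j ∈ B, ‖x j‖ₑ ^ 2) * ∑ j ∈ B, ‖y j‖ₑ ^ 2 := by
  have h : ‖∑ j ∈ B, x j * y j‖ ^ 2 ≤ (∑ j ∈ B, ‖x j‖ ^ 2) * ∑ j ∈ B, ‖y j‖ ^ 2 := by
    refine le_trans ?_ (Finset.sum_mul_sq_le_sq_mul_sq B (fun j => ‖x j‖) (fun j => ‖y j‖))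
    refine pow_le_pow_left₀ (norm_nonneg _) ((norm_sum_le _ _).trans ?_) 2
    simp
  rw [sum_enorm_sq, sum_enorm_sq, ← ENNReal.ofReal_mul (by positivity), ← ofReal_norm,
    ← ENNReal.ofReal_pow (norm_nonneg _)]
  exact ENNReal.ofReal_le_ofReal h

/-- Dual to `sum_sq_le_two_mul_schreier2_sq`: pair with a vector of the unit ball, apply
Cauchy–Schwarz on `B`, and use that the square sum of that vector over `B` is at most 2. -/
theorem dual_schreier2_sq_le {n : ℕ} {B : Finset ℕ} (hcard : B.card ≤ n)
    (hB : ∀ j ∈ B, n / 2 ≤ j) {y : Omega} (hy : ∀ j ∉ B, y j = 0) :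
    schreier2.dual y ^ 2 ≤ 2 * ∑ j ∈ B, ‖y j‖ₑ ^ 2 := by
  -- Moving the square to the other side as a root allows the supremum in the dual norm to be
  -- bounded term by term.
  have hroot : ∀ a b : ℝ≥0∞, a ^ 2 ≤ b ↔ a ≤ b ^ (1 / 2 : ℝ) := by
    intro a b
    rw [← ENNReal.rpow_natCast, one_div, ENNReal.le_rpow_inv_iff (by norm_num)]
    norm_num
  rw [hroot]
  refine iSup₂_le fun x hx => ?_
  rw [← hroot]
  -- The test vector need not be supported in `B`; both sums are compared with the one over the
  -- union of the two sets.
  have hsum : ∑ j ∈ x.support, x j * y j = ∑ j ∈ B, x j * y j := by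
    refine (Finset.sum_subset (Finset.subset_union_left (s₂ := B)) fun j _ hj => ?_).trans
      (Finset.sum_subset Finset.subset_union_right fun j _ hj => ?_).symm
    · simp [Finsupp.notMem_support_iff.1 hj]
    · simp [hy j hj]
  rw [hsum]
  refine (enorm_sum_mul_sq_le B x y).trans ?_
  gcongr
  refine (sum_sq_le_two_mul_schreier2_sq hcard hB x).trans ?_
  calc 2 * schreier2 x ^ 2 ≤ 2 * 1 ^ 2 := by gcongr
    _ = 2 := by norm_num

/-- Dual to `schreier2_sq_le_sum_sq`, hence again without any condition on `B` or on the support of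
`y`: the extremal vector of ℓ₂ on `B` lies in the unit ball of 𝒮². -/
theorem sum_sq_le_dual_schreier2_sq (B : Finset ℕ) (y : Omega) :
    ∑ j ∈ B, ‖y j‖ₑ ^ 2 ≤ schreier2.dual y ^ 2 := by
  set s : ℝ := ∑ j ∈ B, ‖y j‖ ^ 2 with hs
  rw [sum_enorm_sq, ← hs]
  have hs0 : 0 ≤ s := by positivity
  rcases hs0.eq_or_lt with h0 | hpos
  · simp [← h0]
  set r : ℝ := Real.sqrt s
  have hr : 0 < r := Real.sqrt_pos.2 hpos
  have hrs : r ^ 2 = s := Real.sq_sqrt hs0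
  -- The normalized conjugate of `y` on `B`: its ℓ₂ norm is 1 and its pairing with `y` is `r`, the
  -- ℓ₂ norm of `y` on `B`.
  let x : ℕ →₀ ℂ := Finsupp.onFinset B
    (fun j => if j ∈ B then (r⁻¹ : ℂ) * (starRingEnd ℂ) (y j) else 0)
    (by intro j hj; by_contra h; simp [h] at hj)
  have hxB : ∀ j ∉ B, x j = 0 := fun j hj => by simp [x, hj]
  have hxj : ∀ j ∈ B, x j = (r⁻¹ : ℂ) * (starRingEnd ℂ) (y j) := fun j hj => by simp [x, hj]
  have hx : schreier2 x ≤ 1 := by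
    have h : schreier2 x ^ 2 ≤ 1 := by
      refine (schreier2_sq_le_sum_sq hxB).trans (le_of_eq ?_)
      have : ∀ j ∈ B, ‖x j‖ₑ ^ 2 = ENNReal.ofReal (s⁻¹ * ‖y j‖ ^ 2) := by
        intro j hj
        rw [hxj j hj, ← ofReal_norm, ← ENNReal.ofReal_pow (norm_nonneg _), norm_mul, mul_pow]
        simp [hrs]
      rw [Finset.sum_congr rfl this, ← ENNReal.ofReal_sum_of_nonneg fun _ _ => by positivity,
        ← Finset.mul_sum, ← hs, inv_mul_cancel₀ hpos.ne', ENNReal.ofReal_one]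
    by_contra hlt
    exact absurd h (not_le.2 (one_lt_pow₀ (not_le.1 hlt) two_ne_zero))
  have hsum : ∑ j ∈ x.support, x j * y j = (r : ℂ) := by
    have h1 : ∑ j ∈ x.support, x j * y j = ∑ j ∈ B, x j * y j := by
      refine Finset.sum_subset Finsupp.support_onFinset_subset fun j _ hj => ?_
      simp [Finsupp.notMem_support_iff.1 hj]
    have h2 : ∀ j ∈ B, x j * y j = (r⁻¹ : ℂ) * ((‖y j‖ ^ 2 : ℝ) : ℂ) := by
      intro j hj
      rw [hxj j hj, mul_assoc, Complex.conj_mul']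
      simp
    rw [h1, Finset.sum_congr rfl h2, ← Finset.mul_sum, ← Complex.ofReal_sum, ← hs, ← hrs]
    have : (r : ℂ) ≠ 0 := by exact_mod_cast hr.ne'
    push_cast
    field_simp
  have hle : ENNReal.ofReal r ≤ schreier2.dual y := by
    refine le_iSup₂_of_le x hx ?_
    rw [hsum, ← ofReal_norm, Complex.norm_real, Real.norm_of_nonneg hr.le]
  rw [← hrs, ENNReal.ofReal_pow hr.le]
  gcongr

/-! ### Lower estimates for lifts: three lines and Cauchy -/

/-- The coordinates of a function in the Calderón space in a set on which the norms of both
spaces dominate the `ℓ₂` norm form a function into a Euclidean space bounded on the strip. -/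
theorem norm_restrict_le_of_calderonNorm_le {X₀ X₁ : SeqSpace} {F : ℂ → Omega}
    (hF : F ∈ calderonSpace X₀ X₁) {B : Finset ℕ} {c : ℝ}
    (h₀ : ∀ x, ∑ j ∈ B, ‖x j‖ₑ ^ 2 ≤ ENNReal.ofReal c * X₀ x ^ 2)
    (h₁ : ∀ x, ∑ j ∈ B, ‖x j‖ₑ ^ 2 ≤ ENNReal.ofReal c * X₁ x ^ 2)
    {M : ℝ} (hM : 0 ≤ M) (hc : 0 ≤ c) (hFM : calderonNorm X₀ X₁ F ≤ ENNReal.ofReal M)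
    {z : ℂ} (hz : z ∈ closedStrip) :
    ‖(WithLp.toLp 2 (fun j : B => F z j) : EuclideanSpace ℂ B)‖ ≤ Real.sqrt c * M := by
  have hbound : ∀ (X : SeqSpace) (w : Omega),
      (∑ j ∈ B, ‖w j‖ₑ ^ 2 ≤ ENNReal.ofReal c * X w ^ 2) → X w ≤ ENNReal.ofReal M →
      ‖(WithLp.toLp 2 (fun j : B => w j) : EuclideanSpace ℂ B)‖ ≤ Real.sqrt c * M := by
    intro X w h hX
    rw [EuclideanSpace.norm_eq]
    refine Real.sqrt_le_iff.2 ⟨by positivity, ?_⟩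
    rw [mul_pow, Real.sq_sqrt hc]
    have h2 : ∑ j ∈ B, ‖w j‖ₑ ^ 2 ≤ ENNReal.ofReal (c * M ^ 2) := by
      refine h.trans ?_
      rw [ENNReal.ofReal_mul hc, ENNReal.ofReal_pow hM]
      gcongr
    rw [sum_enorm_sq] at h2
    have h3 := (ENNReal.ofReal_le_ofReal_iff (by positivity)).1 h2
    simpa using (Finset.sum_coe_sort B fun j => ‖w j‖ ^ 2).trans_le h3
  obtain ⟨hcont, hbdd, hdiff, -, -⟩ := hF
  have hcl : closure (Complex.re ⁻¹' Ioo 0 1) = closedStrip := by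
    rw [Complex.closure_preimage_re, closure_Ioo (by norm_num)]; rfl
  have hdc : DiffContOnCl ℂ
      (fun z => (WithLp.toLp 2 (fun j : B => F z j) : EuclideanSpace ℂ B))
      (Complex.re ⁻¹' Ioo 0 1) := by
    refine ⟨differentiableOn_euclidean.2 fun j => hdiff j, ?_⟩
    rw [hcl]
    exact (PiLp.continuous_toLp 2 _).comp_continuousOn (continuousOn_pi.2 fun j => hcont j)
  choose b hb using hbdd
  -- The coordinatewise bounds `b` only supply the growth condition and do not enter the final
  -- constant. The function is bounded, so the exponent 0 suffices.
  refine PhragmenLindelof.vertical_strip hdc ⟨0, by simpa using Real.pi_pos, 0, ?_⟩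
    (fun z hz => ?_) (fun z hz => ?_) hz.1 hz.2
  · refine Asymptotics.IsBigO.of_bound (Real.sqrt (∑ j : B, b j ^ 2)) ?_
    filter_upwards [mem_inf_of_right (mem_principal_self _)] with w hw
    rw [EuclideanSpace.norm_eq]
    simp only [zero_mul, Real.exp_zero, norm_one, mul_one]
    refine Real.sqrt_le_sqrt (Finset.sum_le_sum fun j _ => ?_)
    exact pow_le_pow_left₀ (norm_nonneg _) (hb j w ⟨hw.1.le, hw.2.le⟩) 2
  · have hz' : z = (z.im : ℂ) * Complex.I := by apply Complex.ext <;> simp [hz]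
    refine hbound X₀ _ (h₀ _) (le_trans ?_ hFM)
    refine le_max_of_le_left (le_iSup_of_le z.im ?_)
    rw [← hz']
  · have hz' : z = 1 + (z.im : ℂ) * Complex.I := by apply Complex.ext <;> simp [hz]
    refine hbound X₁ _ (h₁ _) (le_trans ?_ hFM)
    refine le_max_of_le_right (le_iSup_of_le z.im ?_)
    rw [← hz']

/-- On coordinates on which the norms of both spaces dominate the `ℓ₂` norm, so does the norm of
the derived space. -/
theorem sum_sq_le_of_mem_calderonLifts {X₀ X₁ : SeqSpace} {p : Omega × Omega} {F : ℂ → Omega}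
    (hF : F ∈ calderonLifts X₀ X₁ p) {B : Finset ℕ} {c : ℝ}
    (h₀ : ∀ x, ∑ j ∈ B, ‖x j‖ₑ ^ 2 ≤ ENNReal.ofReal c * X₀ x ^ 2)
    (h₁ : ∀ x, ∑ j ∈ B, ‖x j‖ₑ ^ 2 ≤ ENNReal.ofReal c * X₁ x ^ 2)
    {M : ℝ} (hM : 0 ≤ M) (hc : 0 ≤ c) (hFM : calderonNorm X₀ X₁ F ≤ ENNReal.ofReal M) :
    ∑ j ∈ B, ‖p.1 j‖ ^ 2 ≤ 16 * c * M ^ 2 ∧ ∑ j ∈ B, ‖p.2 j‖ ^ 2 ≤ c * M ^ 2 := by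
  obtain ⟨hmem, hval, hder⟩ := hF
  let G : ℂ → EuclideanSpace ℂ B := fun z => WithLp.toLp 2 (fun j : B => F z j)
  have hG : ∀ z ∈ closedStrip, ‖G z‖ ≤ Real.sqrt c * M := fun z hz =>
    norm_restrict_le_of_calderonNorm_le hmem h₀ h₁ hM hc hFM hz
  have hnorm : ∀ w : EuclideanSpace ℂ B, ∀ C : ℝ, ‖w‖ ≤ C → ∑ j : B, ‖w j‖ ^ 2 ≤ C ^ 2 := by
    intro w C hw
    rw [← EuclideanSpace.norm_sq_eq]
    exact pow_le_pow_left₀ (norm_nonneg _) hw 2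
  have hsq : (Real.sqrt c * M) ^ 2 = c * M ^ 2 := by rw [mul_pow, Real.sq_sqrt hc]
  constructor
  -- The disc of radius 1/4 about 1/2 stays inside the open strip. Cauchy's inequality on it costs
  -- the factor 4, whose square is the 16 of the statement.
  · have hsub : ∀ z ∈ Metric.closedBall (1 / 2 : ℂ) (1 / 4), z ∈ openStrip := by
      intro z hz
      have h5 : |(z - 1 / 2).re| ≤ 1 / 4 :=
        (Complex.abs_re_le_norm _).trans (by simpa [dist_eq_norm] using hz)
      have h6 : (z - 1 / 2).re = z.re - 1 / 2 := by simp
      rw [h6, abs_le] at h5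
      constructor <;> linarith [h5.1, h5.2]
    have hdiff : DifferentiableOn ℂ G openStrip :=
      differentiableOn_euclidean.2 fun j => hmem.2.2.1 j
    have hd : DiffContOnCl ℂ G (Metric.ball (1 / 2) (1 / 4)) := by
      refine DifferentiableOn.diffContOnCl ?_
      rw [closure_ball _ (by norm_num)]
      exact hdiff.mono hsub
    have hbd := Complex.norm_deriv_le_of_forall_mem_sphere_norm_le (by norm_num) hd fun z hz =>
      hG z ⟨(hsub z (Metric.sphere_subset_closedBall hz)).1.le,
        (hsub z (Metric.sphere_subset_closedBall hz)).2.le⟩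
    have hcoord : ∀ j : B, deriv G (1 / 2) j = p.1 j := by
      intro j
      rw [← hder j]
      have hGd : HasDerivAt G (deriv G (1 / 2)) (1 / 2) :=
        (hdiff.differentiableAt (isOpen_openStrip.mem_nhds half_mem_openStrip)).hasDerivAt
      exact ((EuclideanSpace.proj j : EuclideanSpace ℂ B →L[ℂ] ℂ).hasFDerivAt.comp_hasDerivAt
        _ hGd).deriv.symm
    have := hnorm _ _ hbd
    simp only [hcoord] at this
    rw [Finset.sum_coe_sort B fun j => ‖p.1 j‖ ^ 2, div_pow, hsq] at this
    exact this.trans_eq (by ring)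
  · have := hnorm _ _ (hG (1 / 2) ⟨half_mem_openStrip.1.le, half_mem_openStrip.2.le⟩)
    rw [hsq] at this
    simp only [G, hval] at this
    rwa [Finset.sum_coe_sort B fun j => ‖p.2 j‖ ^ 2] at this

/-! ### Lifts of the basis vectors and of their combinations -/

theorem sum_smul_mem_calderonLifts {X₀ X₁ : SeqSpace} {ι : Type*} (A : Finset ι) (a : ι → ℂ)
    {F : ι → ℂ → Omega} {p : ι → Omega × Omega}
    (hF : ∀ j ∈ A, F j ∈ calderonLifts X₀ X₁ (p j)) :
    ∑ j ∈ A, a j • F j ∈ calderonLifts X₀ X₁ (∑ j ∈ A, a j • p j) := by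
  classical
  induction A using Finset.induction_on with
  | empty => exact ⟨zero_mem _, by simp, by simp⟩
  | insert i A hi ih =>
    rw [Finset.sum_insert hi, Finset.sum_insert hi]
    exact add_mem_calderonLifts (smul_mem_calderonLifts _ (hF i (Finset.mem_insert_self i A)))
      (ih fun j hj => hF j (Finset.mem_insert_of_mem hj))

/-- Every vector of the natural basis has a lift that is a multiple of a unit vector. -/
theorem exists_smul_unitVec_mem_calderonLifts (X : SeqSpace) (j : ℕ) :
    ∃ h : ℂ → ℂ, (∀ z ∈ closedStrip, ‖h z‖ ≤ 3 / 2) ∧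
      (fun z => h z • unitVec (j / 2)) ∈
        calderonLifts X X.dual (DerivedSpace.natBasis X j).1 := by
  by_cases hj : Even j
  -- For `(e, 0)` the scalar factor must vanish at 1/2 with derivative 1. Since `z - 1/2` is
  -- unbounded on the strip, it is divided by `z + 1`; the factor 3/2 restores the derivative, and
  -- it bounds `g` because `|z - 1/2| ≤ |z + 1|` there.
  · let g : ℂ → ℂ := fun z => 3 / 2 * ((z - 1 / 2) / (z + 1))
    have hne : ∀ z : ℂ, 0 ≤ z.re → z + 1 ≠ 0 := by
      intro z hz h0
      have := congrArg Complex.re h0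
      simp at this
      linarith
    have hd : ∀ z : ℂ, 0 ≤ z.re → DifferentiableAt ℂ g z := by
      intro z hz
      have := hne z hz
      fun_prop (disch := assumption)
    have hg : ∀ z ∈ closedStrip, ‖g z‖ ≤ 3 / 2 := by
      intro z hz
      have h1 : ‖z - 1 / 2‖ ≤ ‖z + 1‖ := by
        rw [Complex.norm_def, Complex.norm_def]
        refine Real.sqrt_le_sqrt ?_
        simp only [Complex.normSq_apply, Complex.sub_re, Complex.sub_im, Complex.add_re,
          Complex.add_im, Complex.one_re, Complex.one_im, Complex.div_ofNat_re,
          Complex.div_ofNat_im]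
        nlinarith [hz.1]
      have h2 : ‖(z - 1 / 2) / (z + 1)‖ ≤ 1 := by
        rw [norm_div]
        exact div_le_one_of_le₀ h1 (norm_nonneg _)
      have h3 : ‖(3 / 2 : ℂ)‖ = 3 / 2 := by norm_num
      rw [norm_mul, h3]
      linarith
    have hder : HasDerivAt g 1 (1 / 2) := by
      have h1 : HasDerivAt (fun z : ℂ => z - 1 / 2) 1 (1 / 2) := (hasDerivAt_id _).sub_const _
      have h2 : HasDerivAt (fun z : ℂ => z + 1) 1 (1 / 2) := (hasDerivAt_id _).add_const _
      have h3 := (h1.div h2 (by norm_num)).const_mul (3 / 2 : ℂ)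
      have h4 : (3 / 2 * ((1 * (1 / 2 + 1) - (1 / 2 - 1 / 2) * 1) / (1 / 2 + 1) ^ 2) : ℂ) = 1 := by
        norm_num
      rw [h4] at h3
      exact h3
    refine ⟨g, hg, smul_unitVec_mem_calderonSpace _ g
      (fun z hz => (hd z hz.1).continuousAt.continuousWithinAt) ⟨3 / 2, hg⟩
      (fun z hz => (hd z hz.1.le).differentiableWithinAt), ?_, fun k => ?_⟩
    · simp [g, DerivedSpace.natBasis, hj]
    · have := (hder.mul_const (unitVec (j / 2) k)).deriv
      simpa [DerivedSpace.natBasis, hj] using this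
  · refine ⟨fun _ => 1, fun z _ => by norm_num, smul_unitVec_mem_calderonSpace _ _
      continuousOn_const ⟨1, by simp⟩ (differentiableOn_const _), ?_, fun k => ?_⟩
    · simp [DerivedSpace.natBasis, hj]
    · simp [DerivedSpace.natBasis, hj]

/-! ### Coefficients in the natural basis -/

/-- The coefficient of the `j`-th vector of the natural basis. -/
def natCoord (p : Omega × Omega) (j : ℕ) : ℂ := if Even j then p.1 (j / 2) else p.2 (j / 2)

theorem natCoord_sum_natBasis (X : SeqSpace) (A : Finset ℕ) (a : ℕ → ℂ) {i : ℕ} (hi : i ∈ A) :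
    natCoord (∑ j ∈ A, a j • (DerivedSpace.natBasis X j).1) i = a i := by
  have hbasis : ∀ j, natCoord (a j • (DerivedSpace.natBasis X j).1) i =
      if j = i then a j else 0 := by
    intro j
    -- Halving identifies only an even index with its odd successor, so it is injective on each
    -- parity class.
    have hdiv : Even i → Even j → (j / 2 = i / 2 ↔ j = i) := by
      rintro ⟨m, rfl⟩ ⟨k, rfl⟩; omega
    have hdiv' : ¬ Even i → ¬ Even j → (j / 2 = i / 2 ↔ j = i) := by
      rw [Nat.even_iff, Nat.even_iff]; omega
    by_cases hie : Even i <;> by_cases hje : Even j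
    · simp [natCoord, DerivedSpace.natBasis, hie, hje, unitVec, Pi.single_apply, ← hdiv hie hje,
        eq_comm]
    · have : j ≠ i := by rintro rfl; exact hje hie
      simp [natCoord, DerivedSpace.natBasis, hie, hje, this]
    · have : j ≠ i := by rintro rfl; exact hie hje
      simp [natCoord, DerivedSpace.natBasis, hie, hje, this]
    · simp [natCoord, DerivedSpace.natBasis, hie, hje, unitVec, Pi.single_apply, ← hdiv' hie hje,
        eq_comm]
  have hsum : natCoord (∑ j ∈ A, a j • (DerivedSpace.natBasis X j).1) i
      = ∑ j ∈ A, natCoord (a j • (DerivedSpace.natBasis X j).1) i := by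
    unfold natCoord
    split_ifs
    · rw [Prod.fst_sum, Finset.sum_apply]
    · rw [Prod.snd_sum, Finset.sum_apply]
  simp [hsum, hbasis, hi]

/-- Only `2k` and `2k + 1` are halved to `k`; the first reads the left component and the second the
right one, so no square on the right is used twice. -/
theorem sum_natCoord_sq_le (p : Omega × Omega) (A : Finset ℕ) :
    ∑ j ∈ A, ‖natCoord p j‖ ^ 2 ≤
      ∑ k ∈ A.image (· / 2), ‖p.1 k‖ ^ 2 + ∑ k ∈ A.image (· / 2), ‖p.2 k‖ ^ 2 := by
  rw [← Finset.sum_add_distrib,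
    ← Finset.sum_fiberwise_of_maps_to (fun j hj => Finset.mem_image_of_mem (· / 2) hj)]
  refine Finset.sum_le_sum fun k _ => ?_
  have hsub : A.filter (fun j => j / 2 = k) ⊆ {2 * k, 2 * k + 1} := by
    intro j hj
    have := (Finset.mem_filter.1 hj).2
    simp only [Finset.mem_insert, Finset.mem_singleton]
    omega
  refine (Finset.sum_le_sum_of_subset_of_nonneg hsub fun _ _ _ => by positivity).trans_eq ?_
  have h1 : (2 * k + 1) / 2 = k := by omega
  have h2 : ¬ Even (2 * k + 1) := by rw [Nat.even_iff]; omega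
  rw [Finset.sum_pair (by omega)]
  simp [natCoord, h1, h2]

/-- At most two terms meet at a coordinate, so Cauchy–Schwarz costs a factor 2; together with the
bound 3/2 this gives 2 · (3/2)² = 9/2. -/
theorem sum_sq_combination_le (A : Finset ℕ) (a h : ℕ → ℂ) (hh : ∀ j ∈ A, ‖h j‖ ≤ 3 / 2) :
    ∑ k ∈ A.image (· / 2), ‖(∑ j ∈ A, a j • h j • unitVec (j / 2)) k‖ₑ ^ 2 ≤
      ENNReal.ofReal (9 / 2 * ∑ j ∈ A, ‖a j‖ ^ 2) := by
  have hreal : ∀ k, ‖(∑ j ∈ A, a j • h j • unitVec (j / 2)) k‖ ^ 2 ≤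
      9 / 2 * ∑ j ∈ A with j / 2 = k, ‖a j‖ ^ 2 := by
    intro k
    have hval : (∑ j ∈ A, a j • h j • unitVec (j / 2)) k = ∑ j ∈ A with j / 2 = k, a j * h j := by
      rw [Finset.sum_apply, Finset.sum_filter]
      refine Finset.sum_congr rfl fun j _ => ?_
      simp [unitVec, Pi.single_apply, eq_comm]
    have hsub : A.filter (fun j => j / 2 = k) ⊆ {2 * k, 2 * k + 1} := by
      intro j hj
      have := (Finset.mem_filter.1 hj).2
      simp only [Finset.mem_insert, Finset.mem_singleton]
      omega
    have hcard : ((A.filter (fun j => j / 2 = k)).card : ℝ) ≤ 2 := by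
      exact_mod_cast (Finset.card_le_card hsub).trans Finset.card_le_two
    rw [hval]
    calc ‖∑ j ∈ A with j / 2 = k, a j * h j‖ ^ 2
        ≤ (∑ j ∈ A with j / 2 = k, 3 / 2 * ‖a j‖) ^ 2 := by
          refine pow_le_pow_left₀ (norm_nonneg _) (norm_sum_le_of_le _ fun j hj => ?_) 2
          rw [norm_mul, mul_comm]
          exact mul_le_mul_of_nonneg_right (hh j (Finset.mem_filter.1 hj).1) (norm_nonneg _)
      _ ≤ ((A.filter (fun j => j / 2 = k)).card : ℝ) * ∑ j ∈ A with j / 2 = k, (3 / 2 * ‖a j‖) ^ 2 :=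
          sq_sum_le_card_mul_sum_sq
      _ ≤ 2 * ∑ j ∈ A with j / 2 = k, (3 / 2 * ‖a j‖) ^ 2 := by gcongr
      _ = 9 / 2 * ∑ j ∈ A with j / 2 = k, ‖a j‖ ^ 2 := by
          rw [Finset.mul_sum, Finset.mul_sum]
          exact Finset.sum_congr rfl fun j _ => by ring
  rw [← Finset.sum_fiberwise_of_maps_to (s := A)
      (fun j hj => Finset.mem_image_of_mem (· / 2) hj) fun j => ‖a j‖ ^ 2,
    Finset.mul_sum, ENNReal.ofReal_sum_of_nonneg fun _ _ => by positivity]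
  refine Finset.sum_le_sum fun k _ => ?_
  rw [← ofReal_norm, ← ENNReal.ofReal_pow (norm_nonneg _)]
  exact ENNReal.ofReal_le_ofReal (hreal k)

/-! ### The two-sided estimate -/

theorem derivedNorm_sum_natBasis_le {n : ℕ} {A : Finset ℕ} (hcard : A.card ≤ n)
    (hA : ∀ j ∈ A, n ≤ j) (a : ℕ → ℂ) :
    derivedNorm schreier2 schreier2.dual
      (∑ j ∈ A, a j • (DerivedSpace.natBasis schreier2 j).1) ≤
      ENNReal.ofReal (3 * Real.sqrt (∑ j ∈ A, ‖a j‖ ^ 2)) := by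
  choose h hh hlift using exists_smul_unitVec_mem_calderonLifts schreier2
  set B := A.image (· / 2) with hBdef
  have hBcard : B.card ≤ n := Finset.card_image_le.trans hcard
  have hB : ∀ k ∈ B, n / 2 ≤ k := by
    intro k hk
    obtain ⟨j, hj, rfl⟩ := Finset.mem_image.1 hk
    exact Nat.div_le_div_right (hA j hj)
  have hF := sum_smul_mem_calderonLifts A a fun j _ => hlift j
  refine (iInf_le_of_le ⟨_, hF⟩ le_rfl).trans ?_
  have hz : ∀ z, (∑ j ∈ A, a j • fun z => h j z • unitVec (j / 2)) z
      = ∑ j ∈ A, a j • h j z • unitVec (j / 2) := by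
    intro z
    rw [Finset.sum_apply]
    rfl
  have hsupp : ∀ z, ∀ k ∉ B, (∑ j ∈ A, a j • h j z • unitVec (j / 2)) k = 0 := by
    intro z k hk
    rw [Finset.sum_apply]
    refine Finset.sum_eq_zero fun j hj => ?_
    have : k ≠ j / 2 := by
      rintro rfl
      exact hk (Finset.mem_image_of_mem (· / 2) hj)
    simp [unitVec, this]
  set s : ℝ := ∑ j ∈ A, ‖a j‖ ^ 2 with hs
  have hs0 : 0 ≤ s := by positivity
  have hsum : ∀ z ∈ closedStrip, ∑ k ∈ B, ‖(∑ j ∈ A, a j • h j z • unitVec (j / 2)) k‖ₑ ^ 2 ≤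
      ENNReal.ofReal (9 / 2 * s) := fun z hz =>
    sum_sq_combination_le A a (fun j => h j z) fun j _ => hh j z hz
  -- The 2 is the loss in the dual norm: 2 · 9/2 = 9 is the square of the constant 3.
  have hroot : ∀ b : ℝ≥0∞, b ^ 2 ≤ 2 * ENNReal.ofReal (9 / 2 * s) →
      b ≤ ENNReal.ofReal (3 * Real.sqrt s) := by
    intro b hb
    by_contra hlt
    refine absurd hb (not_le.2 (lt_of_eq_of_lt ?_ (ENNReal.pow_lt_pow_left two_ne_zero
      (not_le.1 hlt))))
    rw [← ENNReal.ofReal_pow (by positivity), mul_pow, Real.sq_sqrt hs0,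
      ← ENNReal.ofReal_ofNat 2, ← ENNReal.ofReal_mul (by norm_num)]
    congr 1
    ring
  refine max_le (iSup_le fun t => ?_) (iSup_le fun t => ?_)
  · have ht : (t * Complex.I : ℂ) ∈ closedStrip := by simp [closedStrip]
    dsimp only
    rw [hz]
    refine hroot _ (((schreier2_sq_le_sum_sq (hsupp _)).trans (hsum _ ht)).trans ?_)
    -- On the line Re z = 0 the norm is that of 𝒮² and the factor 2 is not needed.
    exact le_mul_of_one_le_left zero_le one_le_two
  · have ht : (1 + t * Complex.I : ℂ) ∈ closedStrip := by simp [closedStrip]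
    dsimp only
    rw [hz]
    refine hroot _ ((dual_schreier2_sq_le hBcard hB (hsupp _)).trans ?_)
    gcongr
    exact hsum _ ht

/-- Every lift is tested on the coordinates `j / 2` with `j ∈ A`, where both 𝒮² and its dual
dominate ℓ₂ with the common constant 2 for squares. -/
theorem le_derivedNorm_sum_natBasis {n : ℕ} {A : Finset ℕ} (hcard : A.card ≤ n)
    (hA : ∀ j ∈ A, n ≤ j) (a : ℕ → ℂ) :
    ENNReal.ofReal (6⁻¹ * Real.sqrt (∑ j ∈ A, ‖a j‖ ^ 2)) ≤
      derivedNorm schreier2 schreier2.dual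
        (∑ j ∈ A, a j • (DerivedSpace.natBasis schreier2 j).1) := by
  have hBcard : (A.image (· / 2)).card ≤ n := Finset.card_image_le.trans hcard
  have hB : ∀ k ∈ A.image (· / 2), n / 2 ≤ k := by
    intro k hk
    obtain ⟨j, hj, rfl⟩ := Finset.mem_image.1 hk
    exact Nat.div_le_div_right (hA j hj)
  refine le_iInf fun F => ?_
  have hlt := calderonNorm_lt_top F.2.1
  set M := (calderonNorm schreier2 schreier2.dual F).toReal with hMdef
  have hFM : calderonNorm schreier2 schreier2.dual F = ENNReal.ofReal M :=
    (ENNReal.ofReal_toReal hlt.ne).symm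
  have hM : 0 ≤ M := ENNReal.toReal_nonneg
  obtain ⟨h₁, h₂⟩ := sum_sq_le_of_mem_calderonLifts F.2 (B := A.image (· / 2)) (c := 2)
    (fun x => by simpa using sum_sq_le_two_mul_schreier2_sq hBcard hB x)
    (fun x => (sum_sq_le_dual_schreier2_sq _ x).trans
      (le_mul_of_one_le_left zero_le (by simp))) hM (by norm_num) hFM.le
  have hsum := sum_natCoord_sq_le
    (∑ j ∈ A, a j • (DerivedSpace.natBasis schreier2 j).1) A
  rw [Finset.sum_congr rfl fun i hi => by
    rw [natCoord_sum_natBasis schreier2 A a hi]] at hsum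
  rw [hFM]
  refine ENNReal.ofReal_le_ofReal ?_
  -- The two components contribute 16 · 2 and 2, and 34 ≤ 6².
  have : Real.sqrt (∑ j ∈ A, ‖a j‖ ^ 2) ≤ 6 * M := by
    refine Real.sqrt_le_iff.2 ⟨by positivity, ?_⟩
    nlinarith
  linarith

theorem proposition4p1 :
    ∃ K : ℝ, 1 ≤ K ∧ ∀ n : ℕ, HasEProperty (DerivedSpace.natBasis schreier2) n n K := by
  -- The constant 6 covers both the lower estimate with 1/6 and the upper one with 3. The
  -- exceptional set consists of the first `n` indices, so that `j ≥ n`, hence `j / 2 ≥ n / 2`, for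
  -- all others.
  refine ⟨6, by norm_num, fun n => ⟨Finset.range n, Finset.card_range n, ?_⟩⟩
  intro A hAI hcard a
  have hA : ∀ j ∈ A, n ≤ j := fun j hj => by simpa using hAI hj
  -- The scalars are extended by 0, to pass from sums over the subtype to sums over `A`.
  let b : ℕ → ℂ := fun j => if h : j ∈ A then a ⟨j, h⟩ else 0
  have hb : ∀ j : A, b j = a j := fun j => by simp [b]
  have hnorm : ‖∑ j, a j • DerivedSpace.natBasis schreier2 j‖ =
      (derivedNorm schreier2 schreier2.dual
        (∑ j ∈ A, b j • (DerivedSpace.natBasis schreier2 j).1)).toReal := by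
    have hval : (∑ j : A, a j • DerivedSpace.natBasis schreier2 j).1
        = ∑ j : A, b j • (DerivedSpace.natBasis schreier2 j).1 := by
      simp only [hb]
      exact map_sum (derivedSubmodule schreier2).subtype
        (fun j : A => a j • DerivedSpace.natBasis schreier2 j) Finset.univ
    rw [← Finset.sum_coe_sort A fun j => b j • (DerivedSpace.natBasis schreier2 j).1, ← hval]
    rfl
  have hl2 : ‖∑ j : A, a j • EuclideanSpace.single j (1 : ℂ)‖ = Real.sqrt (∑ j ∈ A, ‖b j‖ ^ 2) := by
    rw [EuclideanSpace.norm_eq, ← Finset.sum_coe_sort A fun j => ‖b j‖ ^ 2]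
    simp [hb, Pi.single_apply]
  have hup := derivedNorm_sum_natBasis_le hcard hA b
  have hlow := le_derivedNorm_sum_natBasis hcard hA b
  rw [hnorm, hl2]
  have hs := Real.sqrt_nonneg (∑ j ∈ A, ‖b j‖ ^ 2)
  constructor
  · exact (ENNReal.ofReal_le_iff_le_toReal (ne_top_of_le_ne_top ENNReal.ofReal_ne_top hup)).1 hlow
  · refine (ENNReal.toReal_le_of_le_ofReal (by positivity) hup).trans ?_
    linarith
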